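/- Let $k$ be a field, let $R = k[x,y,z]$ and $\mathfrak m = (x,y,z)$, let $a_1,a_2,b_1,b_2,c_1,c_2$ be positive integers, and let $$M=\begin{bmatrix} x^{a_1} & y^{b_1} & z^{c_1}\\ z^{c_2} & x^{a_2} & y^{b_2}\end{bmatrix}.$$ Let $P = I_2(M)$ be the ideal of $R$ generated by the $2\times 2$ minors of $M$, and suppose that $P$ is prime. For a positive integer $n$ let $P^{(n)} = P^nR_P\cap R$ denote the $n$-th symbolic power of $P$. Suppose that $M$ is of type 1, that is, $a_1\le a_2$, $b_1\ge b_2$ and $c_1\ge c_2$, or of type 2, that is, $a_1>a_2$, $b_1>b_2$ and $c_1>c_2$. Then $$P^{(3)}\not\subseteq \mathfrak m P^2 \quad\text{if and only if}\quad \alpha_3=\gamma_3=b_2-b_1=0,$$ where $\alpha_3=\max\{0,2a_1-a_2\}$ and $\gamma_3=\max\{0,2c_2-c_1\}$. In particular, if $M$ is of type 2, then $P^{(3)}\subseteq\mathfrak m P^2$. -/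

import Mathlib

open MvPolynomial

namespace SpaceMonomialCurve

/-- The `n`-th symbolic power `P^(n) = P^n R_P ∩ R` of a prime ideal `P` of a commutative ring `R`,
i.e. the contraction to `R` of the extension of `P ^ n` to the localization of `R` at `P`. -/
noncomputable def symbolicPower {R : Type*} [CommRing R] (P : Ideal R) [P.IsPrime] (n : ℕ) :
    Ideal R :=
  ((P ^ n).map (algebraMap R (Localization.AtPrime P))).comap
    (algebraMap R (Localization.AtPrime P))

/-- The ideal `I_t(M)` generated by the `t × t` minors of a matrix `M`. -/
def minorsIdeal {R : Type*} [CommRing R] {m n : ℕ} (t : ℕ) (M : Matrix (Fin m) (Fin n) R) :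
    Ideal R :=
  Ideal.span (Set.range fun e : (Fin t ↪o Fin m) × (Fin t ↪o Fin n) =>
    (M.submatrix e.1 e.2).det)

/-- The matrix with rows `(x^a₁, y^b₁, z^c₁)` and `(z^c₂, x^a₂, y^b₂)` over `k[x, y, z]`,
where `x = X 0`, `y = X 1`, `z = X 2`. -/
noncomputable def herzogMatrix (k : Type*) [Field k] (a₁ a₂ b₁ b₂ c₁ c₂ : ℕ) :
    Matrix (Fin 2) (Fin 3) (MvPolynomial (Fin 3) k) :=
  !![X 0 ^ a₁, X 1 ^ b₁, X 2 ^ c₁;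
     X 2 ^ c₂, X 0 ^ a₂, X 1 ^ b₂]

/-- The inequalities between the exponents of a matrix of type 1. -/
def IsTypeOne (a₁ a₂ b₁ b₂ c₁ c₂ : ℕ) : Prop :=
  a₁ ≤ a₂ ∧ b₂ ≤ b₁ ∧ c₂ ≤ c₁

/-- The inequalities between the exponents of a matrix of type 2. -/
def IsTypeTwo (a₁ a₂ b₁ b₂ c₁ c₂ : ℕ) : Prop :=
  a₂ < a₁ ∧ b₂ < b₁ ∧ c₂ < c₁

/-- The maximal ideal `(x, y, z)` of `k[x, y, z]`. -/
noncomputable def irrelevantIdeal (k : Type*) [Field k] : Ideal (MvPolynomial (Fin 3) k) :=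
  Ideal.span {X 0, X 1, X 2}

end SpaceMonomialCurve

/-!
Let `F, G, H` be the signed minors of the matrix, so that `(F, G, H)` is orthogonal to both rows.

`F` and `G` are relatively prime (`isRelPrime_minors`) and generate `P` after inverting `y`, so they
are quasi-regular: a linear (quadratic) form in `F, G` lies in `P ^ (2)` (in `P ^ (3)`) only if its
coefficients lie in `P`. Eliminating `H` by the second row, this becomes a test for
forms `Q` in all three minors: if `Q(F, G, H)` lies in `P ^ (2)` (linear case, `linear_eval_mem`) or
in `P ^ (3)` (quadratic case, `quadratic_eval_mem`), then `Q(u) ∈ P` for each vector `u` orthogonal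
modulo `P` to the second row. For suitable `u` made of monomials, comparing a single coefficient
of `Q(u)` with the terms of the minors yields information on the coefficients of `Q`. Types 1 and 2
are handled together by writing `a₁ = e + s`, `a₂ = e + t` with `s = 0` or `t = 0`, and
`b₁ = b₂ + β`, `c₁ = c₂ + γ`.

* The test in degree one gives `P ^ (2) = P ^ 2 + (D)` with an explicit `D`
  (`exists_add_secondGen_of_mem_symbolicPower_two`).
* The test in degree two, applied to `x ^ e * (Q + r * D)`, forces `r` into
  `(x ^ e, y ^ b₂, z ^ c₂)`, an ideal that multiplies `D` into `P ^ 2`. So `P ^ (3) ⊆ P ^ 2`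
  (`symbolicPower_three_le_sq`).
* Applied to a quadratic form `Q` with `Q(F, G, H) ∈ P ^ (3)`, it shows that all coefficients of `Q`
  lie in `𝔪`, unless `b₁ = b₂`, `2 * a₁ ≤ a₂` and `2 * c₂ ≤ c₁`
  (`quadratic_coeffs_mem_irrelevantIdeal`).
* In that exceptional case `(D * G - z ^ (c₁ - 2 * c₂) * H ^ 3) / x ^ a₁` is an element of `P ^ (3)`
  which is congruent to `F ^ 2` modulo `𝔪 * P ^ 2`, and `F ^ 2 ∉ 𝔪 * P ^ 2`
  (`not_symbolicPower_three_le`).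
-/

namespace SpaceMonomialCurve

/-! ### Symbolic powers and quasi-regular pairs -/

section Symbolic

variable {R : Type*} [CommRing R] {P : Ideal R} [P.IsPrime]

lemma mem_symbolicPower_iff {n : ℕ} {f : R} :
    f ∈ symbolicPower P n ↔ ∃ s, s ∉ P ∧ s * f ∈ P ^ n := by
  rw [symbolicPower, Ideal.mem_comap,
    IsLocalization.algebraMap_mem_map_algebraMap_iff P.primeCompl]
  rfl

lemma pow_le_symbolicPower (n : ℕ) : P ^ n ≤ symbolicPower P n := fun f hf =>
  mem_symbolicPower_iff.2 ⟨1, (Ideal.ne_top_iff_one P).1 ‹P.IsPrime›.ne_top, by simpa using hf⟩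

lemma symbolicPower_anti {m n : ℕ} (h : m ≤ n) : symbolicPower P n ≤ symbolicPower P m := by
  intro f hf
  obtain ⟨s, hs, hsf⟩ := mem_symbolicPower_iff.1 hf
  exact mem_symbolicPower_iff.2 ⟨s, hs, Ideal.pow_le_pow_right h hsf⟩

lemma mem_symbolicPower_of_mul_mem {n : ℕ} {a f : R} (ha : a ∉ P)
    (h : a * f ∈ symbolicPower P n) : f ∈ symbolicPower P n := by
  obtain ⟨s, hs, hsf⟩ := mem_symbolicPower_iff.1 h
  exact mem_symbolicPower_iff.2
    ⟨s * a, ‹P.IsPrime›.mul_notMem hs ha, by rwa [mul_assoc]⟩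

lemma mul_mem_symbolicPower_succ {n : ℕ} {f g : R} (hf : f ∈ symbolicPower P n) (hg : g ∈ P) :
    f * g ∈ symbolicPower P (n + 1) := by
  obtain ⟨s, hs, hsf⟩ := mem_symbolicPower_iff.1 hf
  exact mem_symbolicPower_iff.2
    ⟨s, hs, by rw [← mul_assoc, pow_succ]; exact Ideal.mul_mem_mul hsf hg⟩

lemma symbolicPower_one_le : symbolicPower P 1 ≤ P := by
  intro f hf
  obtain ⟨s, hs, hsf⟩ := mem_symbolicPower_iff.1 hf
  rw [pow_one] at hsf
  exact (‹P.IsPrime›.mem_or_mem hsf).resolve_left hs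

/-- If `P` is generated by `f, g` after inverting `t ∉ P`, a multiple by an element outside `P` of
an element of `P ^ (n)` lies in `(f, g) ^ n`. -/
lemma exists_mul_mem_span_pair_pow {f g t : R} (ht : t ∉ P)
    (htP : ∀ h ∈ P, t * h ∈ Ideal.span {f, g}) {n : ℕ} {a : R} (ha : a ∈ symbolicPower P n) :
    ∃ s, s ∉ P ∧ s * a ∈ Ideal.span {f, g} ^ n := by
  obtain ⟨s, hs, hsa⟩ := mem_symbolicPower_iff.1 ha
  refine ⟨t ^ n * s, ‹P.IsPrime›.mul_notMem (mt (‹P.IsPrime›.mem_of_pow_mem n) ht) hs, ?_⟩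
  have hle : Ideal.span {t} * P ≤ Ideal.span {f, g} :=
    Ideal.span_singleton_mul_le_iff.2 htP
  have hle' := Ideal.pow_right_mono hle n
  rw [mul_pow, Ideal.span_singleton_pow] at hle'
  rw [mul_assoc]
  exact hle' (Ideal.mul_mem_mul (Ideal.mem_span_singleton_self _) hsa)

lemma mem_span_pair_sq {f g a : R} (h : a ∈ Ideal.span {f, g} ^ 2) :
    ∃ u ∈ Ideal.span {f, g}, ∃ v ∈ Ideal.span {f, g}, a = f * u + g * v := by
  rw [pow_two] at h
  refine Submodule.mul_induction_on h ?_ ?_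
  · intro m hm n hn
    obtain ⟨p, q, rfl⟩ := Ideal.mem_span_pair.1 hm
    exact ⟨p * n, Ideal.mul_mem_left _ _ hn, q * n, Ideal.mul_mem_left _ _ hn, by ring⟩
  · rintro _ _ ⟨u, hu, v, hv, rfl⟩ ⟨u', hu', v', hv', rfl⟩
    exact ⟨u + u', add_mem hu hu', v + v', add_mem hv hv', by ring⟩

lemma mem_span_pair_cube {f g a : R} (h : a ∈ Ideal.span {f, g} ^ 3) :
    ∃ u ∈ Ideal.span {f, g}, ∃ v ∈ Ideal.span {f, g}, a = f ^ 2 * u + g ^ 2 * v := by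
  have hf : f ∈ Ideal.span {f, g} := Ideal.subset_span (by simp)
  have hg : g ∈ Ideal.span {f, g} := Ideal.subset_span (by simp)
  rw [pow_succ'] at h
  refine Submodule.mul_induction_on h ?_ ?_
  · intro m hm n hn
    obtain ⟨p, q, rfl⟩ := Ideal.mem_span_pair.1 hm
    obtain ⟨u, hu, v, hv, rfl⟩ := mem_span_pair_sq hn
    obtain ⟨u₁, u₂, rfl⟩ := Ideal.mem_span_pair.1 hu
    obtain ⟨v₁, v₂, rfl⟩ := Ideal.mem_span_pair.1 hv
    refine ⟨p * (u₁ * f + (u₂ + v₁) * g) + q * u₁ * g, ?_,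
      p * v₂ * f + q * ((u₂ + v₁) * f + v₂ * g), ?_, by ring⟩
    all_goals
      simp only [mul_add, ← mul_assoc]
      repeat' apply add_mem
      all_goals first | exact Ideal.mul_mem_left _ _ hf | exact Ideal.mul_mem_left _ _ hg
  · rintro _ _ ⟨u, hu, v, hv, rfl⟩ ⟨u', hu', v', hv', rfl⟩
    exact ⟨u + u', add_mem hu hu', v + v', add_mem hv hv', by ring⟩

/-- Elements of the square of an ideal with three generators are quadratic forms in them. -/
lemma mem_span_triple_sq {f g h a : R} (ha : a ∈ Ideal.span {f, g, h} ^ 2) :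
    ∃ q₁₁ q₂₂ q₃₃ q₁₂ q₁₃ q₂₃ : R, a = q₁₁ * f ^ 2 + q₂₂ * g ^ 2 + q₃₃ * h ^ 2 +
      q₁₂ * (f * g) + q₁₃ * (f * h) + q₂₃ * (g * h) := by
  rw [pow_two] at ha
  refine Submodule.mul_induction_on ha ?_ ?_
  · intro m hm n hn
    obtain ⟨m₁, m₂, m₃, rfl⟩ := Submodule.mem_span_triple.1 hm
    obtain ⟨n₁, n₂, n₃, rfl⟩ := Submodule.mem_span_triple.1 hn
    exact ⟨m₁ * n₁, m₂ * n₂, m₃ * n₃, m₁ * n₂ + m₂ * n₁, m₁ * n₃ + m₃ * n₁, m₂ * n₃ + m₃ * n₂,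
      by simp only [smul_eq_mul]; ring⟩
  · rintro _ _ ⟨a₁, a₂, a₃, a₄, a₅, a₆, rfl⟩ ⟨b₁, b₂, b₃, b₄, b₅, b₆, rfl⟩
    exact ⟨a₁ + b₁, a₂ + b₂, a₃ + b₃, a₄ + b₄, a₅ + b₅, a₆ + b₆, by ring⟩

variable [DecompositionMonoid R] {f g t : R}

/-- Quasi-regularity of `f, g` in degree one: the classes of `f, g` in `P / P ^ (2)` are
linearly independent over `R / P`. -/
lemma coeff_mem_of_linear_mem_symbolicPower (hfg : IsRelPrime f g) (hf : f ∈ P) (hg : g ∈ P)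
    (ht : t ∉ P) (htP : ∀ h ∈ P, t * h ∈ Ideal.span {f, g}) {A B : R}
    (h : A * f + B * g ∈ symbolicPower P 2) : A ∈ P ∧ B ∈ P := by
  have hJ : Ideal.span {f, g} ≤ P := by
    rw [Ideal.span_le]; rintro _ (rfl | rfl) <;> assumption
  obtain ⟨s, hs, hsa⟩ := exists_mul_mem_span_pair_pow ht htP h
  obtain ⟨u, hu, v, hv, huv⟩ := mem_span_pair_sq hsa
  have h1 : f ∣ s * B - v := hfg.dvd_of_dvd_mul_left
    (z := s * B - v) ⟨u - s * A, by linear_combination huv⟩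
  have h2 : g ∣ s * A - u := hfg.symm.dvd_of_dvd_mul_left
    (z := s * A - u) ⟨v - s * B, by linear_combination huv⟩
  have h1' := add_mem (P.mem_of_dvd h1 hf) (hJ hv)
  have h2' := add_mem (P.mem_of_dvd h2 hg) (hJ hu)
  rw [sub_add_cancel] at h1' h2'
  exact ⟨(‹P.IsPrime›.mem_or_mem h2').resolve_left hs, (‹P.IsPrime›.mem_or_mem h1').resolve_left hs⟩

/-- Quasi-regularity of `f, g` in degree two: the classes of `f ^ 2, f * g, g ^ 2` in
`P ^ (2) / P ^ (3)` are linearly independent over `R / P`. -/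
lemma coeff_mem_of_quadratic_mem_symbolicPower [IsDomain R] (hfg : IsRelPrime f g) (hf : f ∈ P) (hg : g ∈ P)
    (ht : t ∉ P) (htP : ∀ h ∈ P, t * h ∈ Ideal.span {f, g}) {A B C : R}
    (h : A * f ^ 2 + B * (f * g) + C * g ^ 2 ∈ symbolicPower P 3) : A ∈ P ∧ B ∈ P ∧ C ∈ P := by
  have hJ : Ideal.span {f, g} ≤ P := by
    rw [Ideal.span_le]; rintro _ (rfl | rfl) <;> assumption
  have hfg0 : f * g ≠ 0 := by
    intro h0
    rcases mul_eq_zero.1 h0 with rfl | rfl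
    · exact ‹P.IsPrime›.ne_top (P.eq_top_of_isUnit_mem hg (isRelPrime_zero_left.1 hfg))
    · exact ‹P.IsPrime›.ne_top (P.eq_top_of_isUnit_mem hf (isRelPrime_zero_right.1 hfg))
  obtain ⟨s, hs, hsa⟩ := exists_mul_mem_span_pair_pow ht htP h
  obtain ⟨u, hu, v, hv, huv⟩ := mem_span_pair_cube hsa
  obtain ⟨Z, hZ⟩ : f ∣ s * C - v := (hfg.pow_right (n := 2)).dvd_of_dvd_mul_left
    (z := s * C - v) ⟨f * u - s * A * f - s * B * g, by linear_combination huv⟩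
  obtain ⟨X, hX⟩ : g ∣ s * A - u := (hfg.symm.pow_right (n := 2)).dvd_of_dvd_mul_left
    (z := s * A - u) ⟨g * v - s * C * g - s * B * f, by linear_combination huv⟩
  have hB : s * B = -(f * X + g * Z) := by
    apply mul_left_cancel₀ hfg0
    linear_combination huv - f ^ 2 * hX - g ^ 2 * hZ
  have hA' : s * A ∈ P := by
    rw [show s * A = X * g + u by linear_combination hX]
    exact add_mem (P.mul_mem_left _ hg) (hJ hu)
  have hC' : s * C ∈ P := by
    rw [show s * C = Z * f + v by linear_combination hZ]
    exact add_mem (P.mul_mem_left _ hf) (hJ hv)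
  have hB' : s * B ∈ P := by
    rw [hB]
    exact neg_mem (add_mem (P.mul_mem_right _ hf) (P.mul_mem_right _ hg))
  exact ⟨(‹P.IsPrime›.mem_or_mem hA').resolve_left hs, (‹P.IsPrime›.mem_or_mem hB').resolve_left hs,
    (‹P.IsPrime›.mem_or_mem hC').resolve_left hs⟩

end Symbolic

/-! ### Coefficients of combinations of monomials in three variables -/

section Coefficients

variable {k : Type*} [Field k]

/-- The exponent vector of `x ^ i * y ^ j * z ^ l`. -/
noncomputable def expo (i j l : ℕ) : Fin 3 →₀ ℕ := Finsupp.equivFunOnFinite.symm ![i, j, l]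

lemma expo_le_expo {a b c i j l : ℕ} : expo a b c ≤ expo i j l ↔ a ≤ i ∧ b ≤ j ∧ c ≤ l := by
  simp [Finsupp.le_def, Fin.forall_fin_succ, expo]

lemma expo_sub_expo (a b c i j l : ℕ) :
    expo i j l - expo a b c = expo (i - a) (j - b) (l - c) := by
  ext n; fin_cases n <;> simp [expo]

lemma exists_eq_expo (m : Fin 3 →₀ ℕ) : ∃ i j l, m = expo i j l :=
  ⟨m 0, m 1, m 2, by ext n; fin_cases n <;> simp [expo]⟩

lemma expo_zero : expo 0 0 0 = 0 := by
  ext n; fin_cases n <;> simp [expo]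

/-- The monomial `x ^ a * y ^ b * z ^ c`. -/
noncomputable def mono (k : Type*) [Field k] (a b c : ℕ) : MvPolynomial (Fin 3) k :=
  X 0 ^ a * X 1 ^ b * X 2 ^ c

lemma mono_eq_monomial (a b c : ℕ) : mono k a b c = monomial (expo a b c) 1 := by
  rw [monomial_eq, Finsupp.prod_fintype _ _ (by simp)]
  simp [mono, Fin.prod_univ_three, expo]

lemma coeff_mul_mono_of_le {a b c i j l : ℕ} (p : MvPolynomial (Fin 3) k)
    (h : a ≤ i ∧ b ≤ j ∧ c ≤ l) :
    coeff (expo i j l) (p * mono k a b c) = coeff (expo (i - a) (j - b) (l - c)) p := by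
  rw [mono_eq_monomial, coeff_mul_monomial', if_pos (expo_le_expo.2 h), expo_sub_expo, mul_one]

lemma coeff_mul_mono_of_lt {a b c i j l : ℕ} (p : MvPolynomial (Fin 3) k)
    (h : i < a ∨ j < b ∨ l < c) :
    coeff (expo i j l) (p * mono k a b c) = 0 := by
  rw [mono_eq_monomial, coeff_mul_monomial', if_neg]
  rw [expo_le_expo]; omega

/-- Membership in a monomial ideal, tested on the support. -/
lemma mem_span_mono {p : MvPolynomial (Fin 3) k} (T : Set (ℕ × ℕ × ℕ))
    (h : ∀ i j l, coeff (expo i j l) p ≠ 0 → ∃ u ∈ T, u.1 ≤ i ∧ u.2.1 ≤ j ∧ u.2.2 ≤ l) :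
    p ∈ Ideal.span ((fun u => mono k u.1 u.2.1 u.2.2) '' T) := by
  have := (mem_ideal_span_monomial_image (x := p) (s := (fun u => expo u.1 u.2.1 u.2.2) '' T)).2 ?_
  · simpa only [Set.image_image, ← mono_eq_monomial] using this
  · intro m hm
    obtain ⟨i, j, l, rfl⟩ := exists_eq_expo m
    obtain ⟨u, hu, hle⟩ := h i j l (mem_support_iff.1 hm)
    exact ⟨_, ⟨u, hu, rfl⟩, expo_le_expo.2 hle⟩

lemma mem_irrelevantIdeal_iff {p : MvPolynomial (Fin 3) k} :
    p ∈ irrelevantIdeal k ↔ coeff (expo 0 0 0) p = 0 := by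
  constructor
  · intro h
    obtain ⟨u, v, w, rfl⟩ := Submodule.mem_span_triple.1 h
    simp [expo_zero, ← constantCoeff_eq]
  · intro h
    have := mem_span_mono (p := p) {(1, 0, 0), (0, 1, 0), (0, 0, 1)} ?_
    · simpa [Set.image_insert_eq, mono, irrelevantIdeal] using this
    · intro i j l hc
      by_contra hcon
      simp only [Set.mem_insert_iff, Set.mem_singleton_iff, exists_eq_or_imp, exists_eq_left] at hcon
      obtain ⟨rfl, rfl, rfl⟩ : i = 0 ∧ j = 0 ∧ l = 0 := by omega
      exact hc h

end Coefficients

/-! ### The minors of the matrix -/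

section Minors

variable (k : Type*) [Field k]

/-- The minor of the last two columns of the matrix. -/
noncomputable def minorF (a₂ b₁ b₂ c₁ : ℕ) : MvPolynomial (Fin 3) k :=
  X 1 ^ (b₁ + b₂) - X 0 ^ a₂ * X 2 ^ c₁

/-- The minor of the outer two columns of the matrix, with the sign that makes
`(F, G, H)` orthogonal to both rows. -/
noncomputable def minorG (a₁ b₂ c₁ c₂ : ℕ) : MvPolynomial (Fin 3) k :=
  X 2 ^ (c₁ + c₂) - X 0 ^ a₁ * X 1 ^ b₂

/-- The minor of the first two columns of the matrix. -/
noncomputable def minorH (a₁ a₂ b₁ c₂ : ℕ) : MvPolynomial (Fin 3) k :=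
  X 0 ^ (a₁ + a₂) - X 1 ^ b₁ * X 2 ^ c₂

variable {k}

lemma minorsIdeal_herzogMatrix (a₁ a₂ b₁ b₂ c₁ c₂ : ℕ) :
    minorsIdeal 2 (herzogMatrix k a₁ a₂ b₁ b₂ c₁ c₂) =
      Ideal.span {minorF k a₂ b₁ b₂ c₁, minorG k a₁ b₂ c₁ c₂, minorH k a₁ a₂ b₁ c₂} := by
  have emb : ∀ i j : Fin 3, i < j → ∃ e : Fin 2 ↪o Fin 3, e 0 = i ∧ e 1 = j := by
    intro i j hij
    refine ⟨OrderEmbedding.ofStrictMono ![i, j] ?_, rfl, rfl⟩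
    intro u v huv
    fin_cases u <;> fin_cases v <;> simp_all
  have hid : ∀ e : Fin 2 ↪o Fin 2, e 0 = 0 ∧ e 1 = 1 := by
    intro e
    have h : e 0 < e 1 := e.strictMono (by simp)
    omega
  apply le_antisymm
  · rw [minorsIdeal, Ideal.span_le]
    rintro _ ⟨⟨e, f⟩, rfl⟩
    obtain ⟨h0, h1⟩ := hid e
    have hf : f 0 < f 1 := f.strictMono (by simp)
    have hcases : (f 0 = 1 ∧ f 1 = 2) ∨ (f 0 = 0 ∧ f 1 = 2) ∨ (f 0 = 0 ∧ f 1 = 1) := by omega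
    simp only [Matrix.det_fin_two, Matrix.submatrix_apply, h0, h1]
    refine Submodule.mem_span_triple.2 ?_
    rcases hcases with ⟨h2, h3⟩ | ⟨h2, h3⟩ | ⟨h2, h3⟩
    · exact ⟨1, 0, 0, by simp [herzogMatrix, minorF, h2, h3]; ring⟩
    · exact ⟨0, -1, 0, by simp [herzogMatrix, minorG, h2, h3]; ring⟩
    · exact ⟨0, 0, 1, by simp [herzogMatrix, minorH, h2, h3]; ring⟩
  · rw [Ideal.span_le]
    have key : ∀ i j : Fin 3, i < j →
        herzogMatrix k a₁ a₂ b₁ b₂ c₁ c₂ 0 i * herzogMatrix k a₁ a₂ b₁ b₂ c₁ c₂ 1 j -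
          herzogMatrix k a₁ a₂ b₁ b₂ c₁ c₂ 0 j * herzogMatrix k a₁ a₂ b₁ b₂ c₁ c₂ 1 i ∈
        minorsIdeal 2 (herzogMatrix k a₁ a₂ b₁ b₂ c₁ c₂) := by
      intro i j hij
      obtain ⟨f, rfl, rfl⟩ := emb i j hij
      refine Ideal.subset_span ⟨(RelEmbedding.refl _, f), ?_⟩
      simp [Matrix.det_fin_two]
    have h12 := key 1 2 (by decide)
    have h02 := neg_mem (key 0 2 (by decide))
    have h01 := key 0 1 (by decide)
    rintro _ (rfl | rfl | rfl)
    · convert h12 using 1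
      simp [herzogMatrix, minorF]; ring_nf
    · convert h02 using 1
      simp [herzogMatrix, minorG]; ring_nf
    · convert h01 using 1
      simp [herzogMatrix, minorH]; ring_nf

lemma row_two_relation (a₁ a₂ b₁ b₂ c₁ c₂ : ℕ) :
    X 2 ^ c₂ * minorF k a₂ b₁ b₂ c₁ + X 0 ^ a₂ * minorG k a₁ b₂ c₁ c₂ +
      X 1 ^ b₂ * minorH k a₁ a₂ b₁ c₂ = 0 := by
  simp only [minorF, minorG, minorH]; ring

/-- An element of the ideal of minors, written out in monomials. -/
lemma exists_eq_of_mem_minors {a₁ a₂ b₁ b₂ c₁ c₂ : ℕ} {p : MvPolynomial (Fin 3) k}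
    (hp : p ∈ Ideal.span
      {minorF k a₂ b₁ b₂ c₁, minorG k a₁ b₂ c₁ c₂, minorH k a₁ a₂ b₁ c₂}) :
    ∃ A B C, p = A * mono k 0 (b₁ + b₂) 0 - A * mono k a₂ 0 c₁ +
      (B * mono k 0 0 (c₁ + c₂) - B * mono k a₁ b₂ 0) +
      (C * mono k (a₁ + a₂) 0 0 - C * mono k 0 b₁ c₂) := by
  obtain ⟨A, B, C, rfl⟩ := Submodule.mem_span_triple.1 hp
  exact ⟨A, B, C, by simp only [minorF, minorG, minorH, mono, smul_eq_mul]; ring⟩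

section Prime

variable {a₁ a₂ b₁ b₂ c₁ c₂ : ℕ} {P : Ideal (MvPolynomial (Fin 3) k)}

/-- A monomial `m` that no term of the minors divides cannot occur in an element of `P`. -/
lemma coeff_eq_zero_of_mem {p : MvPolynomial (Fin 3) k}
    (hP : P = Ideal.span {minorF k a₂ b₁ b₂ c₁, minorG k a₁ b₂ c₁ c₂, minorH k a₁ a₂ b₁ c₂})
    (hp : p ∈ P) {i j l : ℕ} (h₁ : j < b₁ + b₂) (h₂ : i < a₂ ∨ l < c₁) (h₃ : l < c₁ + c₂)
    (h₄ : i < a₁ ∨ j < b₂) (h₅ : i < a₁ + a₂) (h₆ : j < b₁ ∨ l < c₂) :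
    coeff (expo i j l) p = 0 := by
  obtain ⟨A, B, C, rfl⟩ := exists_eq_of_mem_minors (hP ▸ hp)
  simp (disch := omega) only [coeff_add, coeff_sub, coeff_mul_mono_of_lt, sub_zero, add_zero]

variable (ha₁ : 0 < a₁) (ha₂ : 0 < a₂) (hb₁ : 0 < b₁) (hb₂ : 0 < b₂) (hc₁ : 0 < c₁) (hc₂ : 0 < c₂)
  (hP : P = Ideal.span {minorF k a₂ b₁ b₂ c₁, minorG k a₁ b₂ c₁ c₂, minorH k a₁ a₂ b₁ c₂})

include ha₁ ha₂ hb₁ hb₂ hc₁ hc₂ hP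

lemma X_pow_notMem [P.IsPrime] (i : Fin 3) (n : ℕ) :
    (X i : MvPolynomial (Fin 3) k) ^ n ∉ P := by
  refine mt (‹P.IsPrime›.mem_of_pow_mem n) fun h => ?_
  obtain ⟨u, v, w, hu, hm⟩ : ∃ u v w, u + v + w = 1 ∧ X i = 1 * mono k u v w := by
    fin_cases i
    · exact ⟨1, 0, 0, rfl, by simp [mono]⟩
    · exact ⟨0, 1, 0, rfl, by simp [mono]⟩
    · exact ⟨0, 0, 1, rfl, by simp [mono]⟩
  have := coeff_eq_zero_of_mem hP h (i := u) (j := v) (l := w) (by omega) (by omega) (by omega)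
    (by omega) (by omega) (by omega)
  rw [hm, coeff_mul_mono_of_le _ (by omega)] at this
  simp [expo_zero] at this

/-- Were `p` an irreducible common factor of `F` and `G`, it would divide `H`, so `P` would be
generated by `p`. Then `F / p, G / p, H / p` would generate the unit ideal, although the second row
of the matrix forces each of them to vanish at the origin. -/
lemma isRelPrime_minors [P.IsPrime] :
    IsRelPrime (minorF k a₂ b₁ b₂ c₁) (minorG k a₁ b₂ c₁ c₂) := by
  have hX := X_pow_notMem ha₁ ha₂ hb₁ hb₂ hc₁ hc₂ hP
  have hrel := row_two_relation (k := k) a₁ a₂ b₁ b₂ c₁ c₂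
  have hcoef : ∀ q : MvPolynomial (Fin 3) k, q * minorF k a₂ b₁ b₂ c₁ =
      q * mono k 0 (b₁ + b₂) 0 - q * mono k a₂ 0 c₁ := by
    intro q; simp only [minorF, mono]; ring
  have hF0 : minorF k a₂ b₁ b₂ c₁ ≠ 0 := by
    intro h0
    have h := congrArg (coeff (expo 0 (b₁ + b₂) 0)) (hcoef 1)
    rw [h0, coeff_sub, coeff_mul_mono_of_le _ (by omega), coeff_mul_mono_of_lt _ (by omega)] at h
    simp [expo_zero] at h
  refine WfDvdMonoid.isRelPrime_of_no_irreducible_factors (fun h => hF0 h.1) ?_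
  rintro p hp ⟨F', hF'⟩ ⟨G', hG'⟩
  have hprime : Prime p := hp.prime
  have hpH : p ∣ minorH k a₁ a₂ b₁ c₂ := by
    have h : p ∣ X 1 ^ b₂ * minorH k a₁ a₂ b₁ c₂ :=
      ⟨-(X 2 ^ c₂ * F' + X 0 ^ a₂ * G'), by
        linear_combination hrel - X 2 ^ c₂ * hF' - X 0 ^ a₂ * hG'⟩
    refine (hprime.dvd_or_dvd h).resolve_left fun hy => ?_
    have hy' : p ∣ X 1 := hprime.dvd_of_dvd_pow hy
    -- `p` would be associated to `y`, which does not divide `F`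
    have hass : (X 1 : MvPolynomial (Fin 3) k) ∣ minorF k a₂ b₁ b₂ c₁ :=
      ((hp.associated_of_dvd (X_prime (i := 1)).irreducible hy').dvd_iff_dvd_left.1 ⟨F', hF'⟩)
    obtain ⟨q, hq⟩ := hass
    have h2 := congrArg (coeff (expo a₂ 0 c₁)) (hcoef 1)
    rw [hq, show 1 * (X 1 * q) = q * mono k 0 1 0 by simp [mono]; ring, coeff_sub,
      coeff_mul_mono_of_lt _ (by omega), coeff_mul_mono_of_lt _ (by omega),
      coeff_mul_mono_of_le _ (by omega)] at h2
    simp [expo_zero] at h2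
  obtain ⟨H', hH'⟩ := hpH
  have hle : P ≤ Ideal.span {p} := by
    rw [hP, Ideal.span_le]
    rintro _ (h | h | h)
    · exact Ideal.mem_span_singleton.2 ⟨F', h.trans hF'⟩
    · exact Ideal.mem_span_singleton.2 ⟨G', h.trans hG'⟩
    · exact Ideal.mem_span_singleton.2 ⟨H', Set.mem_singleton_iff.1 h ▸ hH'⟩
  have hFP : minorF k a₂ b₁ b₂ c₁ ∈ P := hP ▸ Ideal.subset_span (by simp)
  have hpP : p ∈ P := by
    obtain ⟨q, hqP, hq⟩ := ‹P.IsPrime›.exists_mem_prime_of_ne_bot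
      (fun h => hF0 (by simpa [h] using hFP))
    have hpq : p ∣ q := Ideal.mem_span_singleton.1 (hle hqP)
    exact P.mem_of_dvd (hp.associated_of_dvd hq.irreducible hpq).symm.dvd hqP
  have hrel' : F' * mono k 0 0 c₂ + G' * mono k a₂ 0 0 + H' * mono k 0 b₂ 0 = 0 := by
    apply mul_left_cancel₀ hp.ne_zero
    simp only [mono]
    linear_combination hrel - X 2 ^ c₂ * hF' - X 0 ^ a₂ * hG' - X 1 ^ b₂ * hH'
  have hz := congrArg (coeff (expo 0 0 c₂)) hrel'
  have hx := congrArg (coeff (expo a₂ 0 0)) hrel'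
  have hy := congrArg (coeff (expo 0 b₂ 0)) hrel'
  simp (disch := omega) only [coeff_add, coeff_mul_mono_of_lt, coeff_mul_mono_of_le, add_zero,
    zero_add, Nat.sub_self, coeff_zero] at hx hy hz
  obtain ⟨A, B, C, hABC⟩ := Submodule.mem_span_triple.1 (hP ▸ hpP)
  have hone : A * F' + B * G' + C * H' = 1 := by
    apply mul_left_cancel₀ hp.ne_zero
    simp only [smul_eq_mul] at hABC
    linear_combination hABC - A * hF' - B * hG' - C * hH'
  have h0 := congrArg constantCoeff hone
  simp only [expo_zero, ← constantCoeff_eq] at hx hy hz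
  simp [hx, hy, hz] at h0

omit ha₁ ha₂ hb₁ hb₂ hc₁ hc₂ in
lemma mul_mem_span_FG : ∀ h ∈ P,
    X 1 ^ b₂ * h ∈ Ideal.span {minorF k a₂ b₁ b₂ c₁, minorG k a₁ b₂ c₁ c₂} := by
  intro h hh
  obtain ⟨A, B, C, rfl⟩ := Submodule.mem_span_triple.1 (hP ▸ hh)
  refine Ideal.mem_span_pair.2 ⟨X 1 ^ b₂ * A - C * X 2 ^ c₂, X 1 ^ b₂ * B - C * X 0 ^ a₂, ?_⟩
  simp only [smul_eq_mul]
  linear_combination -C * row_two_relation (k := k) a₁ a₂ b₁ b₂ c₁ c₂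

/-- A linear form in `F, G, H` lies in `P ^ (2)` only if it vanishes modulo `P` on all vectors that
are orthogonal modulo `P` to the second row of the matrix. -/
lemma linear_eval_mem [P.IsPrime] {α β γ : MvPolynomial (Fin 3) k}
    (h : α * minorF k a₂ b₁ b₂ c₁ + β * minorG k a₁ b₂ c₁ c₂ + γ * minorH k a₁ a₂ b₁ c₂ ∈
      symbolicPower P 2) {u v w : MvPolynomial (Fin 3) k}
    (huvw : X 2 ^ c₂ * u + X 0 ^ a₂ * v + X 1 ^ b₂ * w ∈ P) :
    α * u + β * v + γ * w ∈ P := by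
  have hX := X_pow_notMem ha₁ ha₂ hb₁ hb₂ hc₁ hc₂ hP
  have hrel := row_two_relation (k := k) a₁ a₂ b₁ b₂ c₁ c₂
  have h' := Ideal.mul_mem_left _ (X 1 ^ b₂) h
  obtain ⟨hA, hB⟩ := coeff_mem_of_linear_mem_symbolicPower
    (isRelPrime_minors ha₁ ha₂ hb₁ hb₂ hc₁ hc₂ hP)
    (hP ▸ Ideal.subset_span (by simp)) (hP ▸ Ideal.subset_span (by simp)) (hX 1 b₂)
    (mul_mem_span_FG hP)
    (A := X 1 ^ b₂ * α - γ * X 2 ^ c₂) (B := X 1 ^ b₂ * β - γ * X 0 ^ a₂)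
    (by convert h' using 1; linear_combination -γ * hrel)
  refine (‹P.IsPrime›.mem_or_mem (x := X 1 ^ b₂) ?_).resolve_left (hX 1 b₂)
  have := add_mem (add_mem (P.mul_mem_left u hA) (P.mul_mem_left v hB)) (P.mul_mem_left γ huvw)
  convert this using 1
  ring

/-- A quadratic form in `F, G, H` lies in `P ^ (3)` only if it vanishes modulo `P` on all vectors
that are orthogonal modulo `P` to the second row of the matrix. -/
lemma quadratic_eval_mem [P.IsPrime] {q₁₁ q₂₂ q₃₃ q₁₂ q₁₃ q₂₃ : MvPolynomial (Fin 3) k}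
    (h : q₁₁ * minorF k a₂ b₁ b₂ c₁ ^ 2 + q₂₂ * minorG k a₁ b₂ c₁ c₂ ^ 2 +
      q₃₃ * minorH k a₁ a₂ b₁ c₂ ^ 2 + q₁₂ * (minorF k a₂ b₁ b₂ c₁ * minorG k a₁ b₂ c₁ c₂) +
      q₁₃ * (minorF k a₂ b₁ b₂ c₁ * minorH k a₁ a₂ b₁ c₂) +
      q₂₃ * (minorG k a₁ b₂ c₁ c₂ * minorH k a₁ a₂ b₁ c₂) ∈
      symbolicPower P 3) {u v w : MvPolynomial (Fin 3) k}
    (huvw : X 2 ^ c₂ * u + X 0 ^ a₂ * v + X 1 ^ b₂ * w ∈ P) :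
    q₁₁ * u ^ 2 + q₂₂ * v ^ 2 + q₃₃ * w ^ 2 + q₁₂ * (u * v) + q₁₃ * (u * w) + q₂₃ * (v * w) ∈ P := by
  have hX := X_pow_notMem ha₁ ha₂ hb₁ hb₂ hc₁ hc₂ hP
  have hrel := row_two_relation (k := k) a₁ a₂ b₁ b₂ c₁ c₂
  have h' := Ideal.mul_mem_left _ (X 1 ^ (2 * b₂)) h
  set F := minorF k a₂ b₁ b₂ c₁
  set G := minorG k a₁ b₂ c₁ c₂
  set H := minorH k a₁ a₂ b₁ c₂
  obtain ⟨hA, hB, hC⟩ := coeff_mem_of_quadratic_mem_symbolicPower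
    (isRelPrime_minors ha₁ ha₂ hb₁ hb₂ hc₁ hc₂ hP)
    (hP ▸ Ideal.subset_span (by simp [F])) (hP ▸ Ideal.subset_span (by simp [G])) (hX 1 b₂)
    (mul_mem_span_FG hP)
    (A := q₁₁ * X 1 ^ (2 * b₂) + q₃₃ * X 2 ^ (2 * c₂) - q₁₃ * X 1 ^ b₂ * X 2 ^ c₂)
    (B := q₁₂ * X 1 ^ (2 * b₂) + 2 * q₃₃ * X 0 ^ a₂ * X 2 ^ c₂ - q₁₃ * X 1 ^ b₂ * X 0 ^ a₂ -
      q₂₃ * X 1 ^ b₂ * X 2 ^ c₂)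
    (C := q₂₂ * X 1 ^ (2 * b₂) + q₃₃ * X 0 ^ (2 * a₂) - q₂₃ * X 0 ^ a₂ * X 1 ^ b₂)
    (by
      convert h' using 1
      linear_combination -(q₃₃ * (X 1 ^ b₂ * H - X 2 ^ c₂ * F - X 0 ^ a₂ * G) +
        q₁₃ * X 1 ^ b₂ * F + q₂₃ * X 1 ^ b₂ * G) * hrel)
  refine (‹P.IsPrime›.mem_or_mem (x := X 1 ^ (2 * b₂)) ?_).resolve_left (hX 1 _)
  have := add_mem (add_mem (add_mem (P.mul_mem_left (u ^ 2) hA) (P.mul_mem_left (u * v) hB))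
    (P.mul_mem_left (v ^ 2) hC)) (P.mul_mem_left (q₃₃ * (X 1 ^ b₂ * w - X 2 ^ c₂ * u - X 0 ^ a₂ * v) +
        q₁₃ * X 1 ^ b₂ * u + q₂₃ * X 1 ^ b₂ * v) huvw)
  convert this using 1
  ring

end Prime

end Minors

/-! ### The second symbolic power -/

section SymbolicPowers

variable {k : Type*} [Field k]

/-- The generator of `P ^ (2)` modulo `P ^ 2`, for the matrix with exponents `a₁ = e + s`,
`a₂ = e + t`, `b₁ = b + β`, `b₂ = b`, `c₁ = c + γ`, `c₂ = c`. -/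
noncomputable def secondGen (k : Type*) [Field k] (e s t b β c γ : ℕ) : MvPolynomial (Fin 3) k :=
  -(X 0 ^ s * X 1 ^ (b + β) * minorF k (e + t) (b + β) b (c + γ) +
    X 0 ^ t * X 1 ^ β * X 2 ^ (c + γ) * minorG k (e + s) b (c + γ) c +
    X 0 ^ (e + s + t) * X 2 ^ γ * minorH k (e + s) (e + t) (b + β) c)

variable {e s t b β c γ : ℕ} {F G H : MvPolynomial (Fin 3) k} {P : Ideal (MvPolynomial (Fin 3) k)}
  (hF : F = minorF k (e + t) (b + β) b (c + γ)) (hG : G = minorG k (e + s) b (c + γ) c)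
  (hH : H = minorH k (e + s) (e + t) (b + β) c)

include hF hG hH

lemma X_zero_pow_mul_secondGen :
    X 0 ^ e * secondGen k e s t b β c γ = X 1 ^ β * F * G - X 2 ^ γ * H ^ 2 := by
  simp only [secondGen, hF, hG, hH, minorF, minorG, minorH]; ring

lemma X_one_pow_mul_secondGen :
    X 1 ^ b * secondGen k e s t b β c γ = X 0 ^ t * X 2 ^ γ * G * H - X 0 ^ s * F ^ 2 := by
  simp only [secondGen, hF, hG, hH, minorF, minorG, minorH]; ring

lemma X_two_pow_mul_secondGen :
    X 2 ^ c * secondGen k e s t b β c γ = X 0 ^ s * F * H - X 0 ^ t * X 1 ^ β * G ^ 2 := by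
  simp only [secondGen, hF, hG, hH, minorF, minorG, minorH]; ring

variable (he : 0 < e) (hb : 0 < b) (hc : 0 < c) (hP : P = Ideal.span {F, G, H})

include hP

omit hF hG hH in
lemma minors_mem : F ∈ P ∧ G ∈ P ∧ H ∈ P := by
  subst hP
  exact ⟨Ideal.subset_span (by simp), Ideal.subset_span (by simp), Ideal.subset_span (by simp)⟩

lemma mul_secondGen_mem_sq {r : MvPolynomial (Fin 3) k}
    (hr : r ∈ Ideal.span {X 0 ^ e, X 1 ^ b, X 2 ^ c}) :
    r * secondGen k e s t b β c γ ∈ P ^ 2 := by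
  obtain ⟨hFP, hGP, hHP⟩ := minors_mem hP
  have hmul : ∀ {p u v : MvPolynomial (Fin 3) k}, u ∈ P → v ∈ P → p * (u * v) ∈ P ^ 2 :=
    fun hu hv => Ideal.mul_mem_left _ _ (pow_two P ▸ Ideal.mul_mem_mul hu hv)
  obtain ⟨p, q, w, rfl⟩ := Submodule.mem_span_triple.1 hr
  rw [show (p • X 0 ^ e + q • X 1 ^ b + w • X 2 ^ c) * secondGen k e s t b β c γ =
      (p * X 1 ^ β) * (F * G) + (-p * X 2 ^ γ) * (H * H) + (q * X 0 ^ t * X 2 ^ γ) * (G * H) +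
      (-q * X 0 ^ s) * (F * F) + (w * X 0 ^ s) * (F * H) + (-w * X 0 ^ t * X 1 ^ β) * (G * G) by
    simp only [smul_eq_mul]
    linear_combination p * X_zero_pow_mul_secondGen hF hG hH +
      q * X_one_pow_mul_secondGen hF hG hH + w * X_two_pow_mul_secondGen hF hG hH]
  repeat' apply add_mem
  all_goals apply hmul <;> assumption

include he hb hc

lemma secondGen_mem_symbolicPower [P.IsPrime] :
    secondGen k e s t b β c γ ∈ symbolicPower P 2 := by
  have hX : (X 0 : MvPolynomial (Fin 3) k) ^ e ∉ P := X_pow_notMem (a₁ := e + s) (a₂ := e + t)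
    (b₁ := b + β) (b₂ := b) (c₁ := c + γ) (c₂ := c) (by omega) (by omega) (by omega) hb (by omega)
    hc (by rw [hP, hF, hG, hH]) 0 e
  exact mem_symbolicPower_of_mul_mem hX
    (pow_le_symbolicPower _ (mul_secondGen_mem_sq hF hG hH hP (Ideal.subset_span (by simp))))

/-- `P ^ (2)` is generated by `P ^ 2` and one more element. For `p * F + q * G + r * H` in
`P ^ (2)`, testing against two vectors orthogonal to the second row shows that `r` lies modulo `P`
in the ideal of the `H`-coordinates of the two rows and of `secondGen`; subtracting
multiples of these makes all coordinates elements of `P`. -/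
lemma exists_add_secondGen_of_mem_symbolicPower_two [P.IsPrime] (hst : s = 0 ∨ t = 0)
    {f : MvPolynomial (Fin 3) k} (hf : f ∈ symbolicPower P 2) :
    ∃ g ∈ P ^ 2, ∃ r, f = g + r * secondGen k e s t b β c γ := by
  have hP' : P = Ideal.span {minorF k (e + t) (b + β) b (c + γ), minorG k (e + s) b (c + γ) c,
    minorH k (e + s) (e + t) (b + β) c} := by rw [hP, hF, hG, hH]
  have hX := X_pow_notMem (by omega) (by omega) (by omega) hb (by omega) hc hP'
  obtain ⟨hFP, hGP, hHP⟩ := minors_mem hP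
  have htest : ∀ {p q r : MvPolynomial (Fin 3) k}, p * F + q * G + r * H ∈ symbolicPower P 2 →
      p * X 1 ^ b - r * X 2 ^ c ∈ P ∧ q * X 1 ^ b - r * X 0 ^ (e + t) ∈ P := by
    intro p q r h
    rw [hF, hG, hH] at h
    have h1 := linear_eval_mem (by omega) (by omega) (by omega) hb (by omega) hc hP' h
      (u := X 1 ^ b) (v := 0) (w := -X 2 ^ c) (by ring_nf; exact P.zero_mem)
    have h2 := linear_eval_mem (by omega) (by omega) (by omega) hb (by omega) hc hP' h
      (u := 0) (v := X 1 ^ b) (w := -X 0 ^ (e + t)) (by ring_nf; exact P.zero_mem)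
    constructor
    · convert h1 using 1; ring
    · convert h2 using 1; ring
  have hfP : f ∈ P := symbolicPower_one_le (symbolicPower_anti one_le_two hf)
  obtain ⟨p, q, r, rfl⟩ := Submodule.mem_span_triple.1 (hP ▸ hfP)
  simp only [smul_eq_mul] at hf ⊢
  obtain ⟨h1, h2⟩ := htest hf
  have hr : r ∈ Ideal.span {X 1 ^ b, X 2 ^ (c + γ), X 0 ^ (e + s + t) * X 2 ^ γ,
      X 0 ^ (2 * e + s + t)} := by
    have := mem_span_mono (p := r)
      {(0, b, 0), (0, 0, c + γ), (e + s + t, 0, γ), (2 * e + s + t, 0, 0)} ?_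
    · simpa [Set.image_insert_eq, mono] using this
    intro i j l hne
    by_contra hcon
    simp only [Set.mem_insert_iff, Set.mem_singleton_iff, exists_eq_or_imp, exists_eq_left] at hcon
    rw [show p * X 1 ^ b - r * X 2 ^ c = p * mono k 0 b 0 - r * mono k 0 0 c by
      simp [mono]] at h1
    rw [show q * X 1 ^ b - r * X 0 ^ (e + t) = q * mono k 0 b 0 - r * mono k (e + t) 0 0 by
      simp [mono]] at h2
    have hil : e + t ≤ i ∧ γ ≤ l := by
      by_contra hil
      have h := coeff_eq_zero_of_mem hP' h1 (i := i) (j := j) (l := l + c) (by omega) (by omega)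
        (by omega) (by omega) (by omega) (by omega)
      rw [coeff_sub, coeff_mul_mono_of_lt _ (by omega), coeff_mul_mono_of_le _ (by omega)] at h
      simp only [Nat.sub_zero, Nat.add_sub_cancel, zero_sub, neg_eq_zero] at h
      exact hne h
    have hi : e + s ≤ i := by
      by_contra hi
      have h := coeff_eq_zero_of_mem hP' h2 (i := i + (e + t)) (j := j) (l := l) (by omega)
        (by omega) (by omega) (by omega) (by omega) (by omega)
      rw [coeff_sub, coeff_mul_mono_of_lt _ (by omega), coeff_mul_mono_of_le _ (by omega)] at h
      simp only [Nat.sub_zero, Nat.add_sub_cancel, zero_sub, neg_eq_zero] at h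
      exact hne h
    omega
  obtain ⟨r₁, _, hr', rfl⟩ := Ideal.mem_span_insert.1 hr
  obtain ⟨r₂, r₃, r₄, rfl⟩ := Submodule.mem_span_triple.1 hr'
  simp only [smul_eq_mul] at hf ⊢
  set D := secondGen k e s t b β c γ with hD
  -- the powers of `x` in the last generator are traded for `H` plus a multiple of `y ^ b`
  set p' := p - (r₁ + r₄ * X 1 ^ β * X 2 ^ c) * X 2 ^ c - r₂ * X 0 ^ (e + s) -
    r₃ * X 0 ^ s * X 1 ^ (b + β) with hp'
  set q' := q - (r₁ + r₄ * X 1 ^ β * X 2 ^ c) * X 0 ^ (e + t) - r₂ * X 1 ^ (b + β) -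
    r₃ * X 0 ^ t * X 1 ^ β * X 2 ^ (c + γ) with hq'
  have hkey : p * F + q * G + (r₁ * X 1 ^ b + (r₂ * X 2 ^ (c + γ) +
      r₃ * (X 0 ^ (e + s + t) * X 2 ^ γ) + r₄ * X 0 ^ (2 * e + s + t))) * H + r₃ * D =
      p' * F + q' * G + (r₄ * H) * H := by
    simp only [hp', hq', hD, secondGen, hF, hG, hH, minorF, minorG, minorH]; ring
  have hmem := add_mem hf
    (Ideal.mul_mem_left _ r₃ (secondGen_mem_symbolicPower hF hG hH he hb hc hP))
  rw [← hD, hkey] at hmem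
  obtain ⟨h3, h4⟩ := htest hmem
  have hpq : ∀ {v : MvPolynomial (Fin 3) k}, v * X 1 ^ b ∈ P → v ∈ P :=
    fun h => (‹P.IsPrime›.mem_or_mem h).resolve_right (hX 1 b)
  have hp : p' ∈ P := by
    apply hpq
    rw [show p' * X 1 ^ b = p' * X 1 ^ b - r₄ * H * X 2 ^ c + r₄ * X 2 ^ c * H by ring]
    exact add_mem h3 (P.mul_mem_left _ hHP)
  have hq : q' ∈ P := by
    apply hpq
    rw [show q' * X 1 ^ b = q' * X 1 ^ b - r₄ * H * X 0 ^ (e + t) + r₄ * X 0 ^ (e + t) * H by ring]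
    exact add_mem h4 (P.mul_mem_left _ hHP)
  refine ⟨p' * F + q' * G + (r₄ * H) * H, ?_, -r₃, by linear_combination hkey⟩
  rw [pow_two]
  exact add_mem (add_mem (Ideal.mul_mem_mul hp hFP) (Ideal.mul_mem_mul hq hGP))
    (Ideal.mul_mem_mul (P.mul_mem_left _ hHP) hHP)

/-! ### The third symbolic power -/

lemma symbolicPower_three_le_sq [P.IsPrime] (hst : s = 0 ∨ t = 0) :
    symbolicPower P 3 ≤ P ^ 2 := by
  intro f hf
  have hP' : P = Ideal.span {minorF k (e + t) (b + β) b (c + γ), minorG k (e + s) b (c + γ) c,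
    minorH k (e + s) (e + t) (b + β) c} := by rw [hP, hF, hG, hH]
  have hX := X_pow_notMem (by omega) (by omega) (by omega) hb (by omega) hc hP'
  obtain ⟨g, hg, r, rfl⟩ := exists_add_secondGen_of_mem_symbolicPower_two hF hG hH he hb hc hP hst
    (symbolicPower_anti (by norm_num) hf)
  refine add_mem hg (mul_secondGen_mem_sq hF hG hH hP ?_)
  obtain ⟨q₁₁, q₂₂, q₃₃, q₁₂, q₁₃, q₂₃, rfl⟩ := mem_span_triple_sq (hP ▸ hg)
  have h := Ideal.mul_mem_left _ (X 0 ^ e) hf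
  rw [show ∀ Q D : MvPolynomial (Fin 3) k, X 0 ^ e * (Q + r * D) = X 0 ^ e * Q + r * (X 0 ^ e * D)
    by intros; ring, X_zero_pow_mul_secondGen hF hG hH] at h
  have hQ := quadratic_eval_mem (by omega) (by omega) (by omega) hb (by omega) hc hP'
    (q₁₁ := X 0 ^ e * q₁₁) (q₂₂ := X 0 ^ e * q₂₂) (q₃₃ := X 0 ^ e * q₃₃ - r * X 2 ^ γ)
    (q₁₂ := X 0 ^ e * q₁₂ + r * X 1 ^ β) (q₁₃ := X 0 ^ e * q₁₃) (q₂₃ := X 0 ^ e * q₂₃)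
    (by rw [← hF, ← hG, ← hH]; convert h using 1; ring)
    (u := X 1 ^ b) (v := 0) (w := -X 2 ^ c) (by ring_nf; exact P.zero_mem)
  -- `z ^ (c₁ + c₂)` agrees modulo `P` with `x ^ a₁ * y ^ b₂`, so `x ^ e` can be cancelled
  have hE : q₁₁ * mono k 0 (2 * b) 0 + q₃₃ * mono k 0 0 (2 * c) - q₁₃ * mono k 0 b c -
      r * mono k s b 0 ∈ P := by
    refine (‹P.IsPrime›.mem_or_mem (x := X 0 ^ e) ?_).resolve_left (hX 0 e)
    have := add_mem hQ (P.mul_mem_left r (minors_mem hP).2.1)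
    convert this using 1
    simp only [mono, hG, minorG]; ring
  have := mem_span_mono (p := r) {(e, 0, 0), (0, b, 0), (0, 0, c)} ?_
  · simpa [Set.image_insert_eq, mono] using this
  intro i j l hne
  by_contra hcon
  simp only [Set.mem_insert_iff, Set.mem_singleton_iff, exists_eq_or_imp, exists_eq_left] at hcon
  have h := coeff_eq_zero_of_mem hP' hE (i := i + s) (j := j + b) (l := l) (by omega) (by omega)
    (by omega) (by omega) (by omega) (by omega)
  rw [coeff_sub, coeff_sub, coeff_add, coeff_mul_mono_of_lt _ (by omega),
    coeff_mul_mono_of_lt _ (by omega), coeff_mul_mono_of_lt _ (by omega),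
    coeff_mul_mono_of_le _ (by omega)] at h
  simp only [Nat.sub_zero, Nat.add_sub_cancel, add_zero, zero_sub, neg_zero, neg_eq_zero] at h
  exact hne h

/-- Outside the exceptional case, a quadratic form in `F, G, H` that lies in `P ^ (3)` has all its
coefficients in `𝔪`. Each constant coefficient is read off from the vanishing modulo `P` of the
form at a suitable vector orthogonal to the rows, in some cases after cancelling a monomial common
to all terms modulo `P`. -/
lemma quadratic_coeffs_mem_irrelevantIdeal [P.IsPrime]
    (htype : s = 0 ∨ (t = 0 ∧ 0 < s ∧ 0 < β ∧ 0 < γ)) (hex : ¬(β = 0 ∧ e ≤ t ∧ c ≤ γ))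
    {q₁₁ q₂₂ q₃₃ q₁₂ q₁₃ q₂₃ : MvPolynomial (Fin 3) k}
    (h : q₁₁ * F ^ 2 + q₂₂ * G ^ 2 + q₃₃ * H ^ 2 + q₁₂ * (F * G) + q₁₃ * (F * H) + q₂₃ * (G * H) ∈
      symbolicPower P 3) :
    (q₁₁ ∈ irrelevantIdeal k ∧ q₂₂ ∈ irrelevantIdeal k ∧ q₃₃ ∈ irrelevantIdeal k) ∧
      q₁₂ ∈ irrelevantIdeal k ∧ q₁₃ ∈ irrelevantIdeal k ∧ q₂₃ ∈ irrelevantIdeal k := by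
  have hP' : P = Ideal.span {minorF k (e + t) (b + β) b (c + γ), minorG k (e + s) b (c + γ) c,
    minorH k (e + s) (e + t) (b + β) c} := by rw [hP, hF, hG, hH]
  have hX := X_pow_notMem (by omega) (by omega) (by omega) hb (by omega) hc hP'
  have hcancel : ∀ (i : Fin 3) (n : ℕ) {v : MvPolynomial (Fin 3) k}, X i ^ n * v ∈ P → v ∈ P :=
    fun i n _ h => (‹P.IsPrime›.mem_or_mem h).resolve_left (hX i n)
  obtain ⟨hFP, hGP, hHP⟩ := minors_mem hP
  rw [hF, hG, hH] at h
  have heval := fun u v w => quadratic_eval_mem (by omega) (by omega) (by omega) hb (by omega) hc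
    hP' h (u := u) (v := v) (w := w)
  have hxz : q₁₁ * mono k 0 (2 * b) 0 + q₃₃ * mono k 0 0 (2 * c) - q₁₃ * mono k 0 b c ∈ P := by
    have := heval (X 1 ^ b) 0 (-X 2 ^ c) (by ring_nf; exact P.zero_mem)
    convert this using 1
    simp only [mono]; ring
  have hxz' : β = 0 →
      q₁₁ * mono k (e + t) 0 γ + q₃₃ * mono k 0 0 c - q₁₃ * mono k 0 b 0 ∈ P := by
    rintro rfl
    apply hcancel 2 c
    have := sub_mem hxz (P.mul_mem_left q₁₁ hFP)
    convert this using 1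
    simp only [mono, hF, minorF]; ring
  have hyz : q₂₂ * mono k 0 (2 * b) 0 + q₃₃ * mono k (2 * (e + t)) 0 0 -
      q₂₃ * mono k (e + t) b 0 ∈ P := by
    have := heval 0 (X 1 ^ b) (-X 0 ^ (e + t)) (by ring_nf; exact P.zero_mem)
    convert this using 1
    simp only [mono]; ring
  have hyz' : s = 0 →
      q₂₂ * mono k 0 b 0 + q₃₃ * mono k t β c - q₂₃ * mono k (e + t) 0 0 ∈ P := by
    rintro rfl
    apply hcancel 1 b
    have := sub_mem hyz (P.mul_mem_left (q₃₃ * X 0 ^ t) hHP)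
    convert this using 1
    simp only [mono, hH, minorH]; ring
  have hxy : q₁₁ * mono k (2 * (e + t)) 0 0 + q₂₂ * mono k 0 0 (2 * c) -
      q₁₂ * mono k (e + t) 0 c ∈ P := by
    have := heval (X 0 ^ (e + t)) (-X 2 ^ c) 0 (by ring_nf; exact P.zero_mem)
    convert this using 1
    simp only [mono]; ring
  have hxy' : s = 0 →
      q₁₁ * mono k t β (c + γ) + q₂₂ * mono k e 0 0 - q₁₂ * mono k 0 (b + β) 0 ∈ P := by
    rintro rfl
    apply hcancel 0 e
    have := heval (X 1 ^ (b + β)) (-X 0 ^ e) 0 (by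
      convert neg_mem hHP using 1; simp only [hH, minorH]; ring)
    have := sub_mem this (P.mul_mem_left (q₁₁ * X 1 ^ β) hFP)
    convert this using 1
    simp only [mono, hF, minorF]; ring
  have hzx' : s = 0 →
      q₁₁ * mono k 0 b γ + q₃₃ * mono k e 0 0 - q₁₃ * mono k 0 0 (c + γ) ∈ P := by
    rintro rfl
    apply hcancel 0 e
    have := heval (X 2 ^ (c + γ)) 0 (-X 0 ^ e) (by
      convert hGP using 1; simp only [hG, minorG]; ring)
    have := sub_mem this (P.mul_mem_left (q₁₁ * X 2 ^ γ) hGP)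
    convert this using 1
    simp only [mono, hG, minorG]; ring
  simp only [mem_irrelevantIdeal_iff]
  refine ⟨⟨?_, ?_, ?_⟩, ?_, ?_, ?_⟩
  · rcases Nat.eq_zero_or_pos β with hβ | hβ
    · rcases lt_or_ge γ c with hγ | hγ
      · have := coeff_eq_zero_of_mem hP' (hxz' hβ) (i := e + t) (j := 0) (l := γ) (by omega)
          (by omega) (by omega) (by omega) (by omega) (by omega)
        simpa (disch := omega) only [coeff_add, coeff_sub, coeff_mul_mono_of_lt,
          coeff_mul_mono_of_le, Nat.sub_self, add_zero, sub_zero] using this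
      · have hs : s = 0 := by omega
        have := coeff_eq_zero_of_mem hP' (hxy' hs) (i := t) (j := β) (l := c + γ) (by omega)
          (by omega) (by omega) (by omega) (by omega) (by omega)
        simpa (disch := omega) only [coeff_add, coeff_sub, coeff_mul_mono_of_lt,
          coeff_mul_mono_of_le, Nat.sub_self, add_zero, sub_zero] using this
    · have := coeff_eq_zero_of_mem hP' hxz (i := 0) (j := 2 * b) (l := 0) (by omega)
        (by omega) (by omega) (by omega) (by omega) (by omega)
      simpa (disch := omega) only [coeff_add, coeff_sub, coeff_mul_mono_of_lt,
        coeff_mul_mono_of_le, Nat.sub_self, add_zero, sub_zero] using this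
  · rcases htype with hs | ht
    · have := coeff_eq_zero_of_mem hP' (hxy' hs) (i := e) (j := 0) (l := 0) (by omega)
        (by omega) (by omega) (by omega) (by omega) (by omega)
      simpa (disch := omega) only [coeff_add, coeff_sub, coeff_mul_mono_of_lt,
        coeff_mul_mono_of_le, Nat.sub_self, zero_add, sub_zero] using this
    · have := coeff_eq_zero_of_mem hP' hyz (i := 0) (j := 2 * b) (l := 0) (by omega)
        (by omega) (by omega) (by omega) (by omega) (by omega)
      simpa (disch := omega) only [coeff_add, coeff_sub, coeff_mul_mono_of_lt,
        coeff_mul_mono_of_le, Nat.sub_self, add_zero, sub_zero] using this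
  · rcases htype with hs | ht
    · have := coeff_eq_zero_of_mem hP' (hzx' hs) (i := e) (j := 0) (l := 0) (by omega)
        (by omega) (by omega) (by omega) (by omega) (by omega)
      simpa (disch := omega) only [coeff_add, coeff_sub, coeff_mul_mono_of_lt,
        coeff_mul_mono_of_le, Nat.sub_self, zero_add, sub_zero] using this
    · have := coeff_eq_zero_of_mem hP' hxz (i := 0) (j := 0) (l := 2 * c) (by omega)
        (by omega) (by omega) (by omega) (by omega) (by omega)
      simpa (disch := omega) only [coeff_add, coeff_sub, coeff_mul_mono_of_lt,
        coeff_mul_mono_of_le, Nat.sub_self, zero_add, sub_zero] using this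
  · rcases htype with hs | ht
    · have := coeff_eq_zero_of_mem hP' (hxy' hs) (i := 0) (j := b + β) (l := 0) (by omega)
        (by omega) (by omega) (by omega) (by omega) (by omega)
      simpa (disch := omega) only [coeff_add, coeff_sub, coeff_mul_mono_of_lt,
        coeff_mul_mono_of_le, Nat.sub_self, zero_add, zero_sub, neg_eq_zero] using this
    · have := coeff_eq_zero_of_mem hP' hxy (i := e + t) (j := 0) (l := c) (by omega)
        (by omega) (by omega) (by omega) (by omega) (by omega)
      simpa (disch := omega) only [coeff_add, coeff_sub, coeff_mul_mono_of_lt,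
        coeff_mul_mono_of_le, Nat.sub_self, zero_add, zero_sub, neg_eq_zero] using this
  · rcases Nat.eq_zero_or_pos β with hβ | hβ
    · have := coeff_eq_zero_of_mem hP' (hxz' hβ) (i := 0) (j := b) (l := 0) (by omega)
        (by omega) (by omega) (by omega) (by omega) (by omega)
      simpa (disch := omega) only [coeff_add, coeff_sub, coeff_mul_mono_of_lt,
        coeff_mul_mono_of_le, Nat.sub_self, zero_add, zero_sub, neg_eq_zero] using this
    · have := coeff_eq_zero_of_mem hP' hxz (i := 0) (j := b) (l := c) (by omega)
        (by omega) (by omega) (by omega) (by omega) (by omega)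
      simpa (disch := omega) only [coeff_add, coeff_sub, coeff_mul_mono_of_lt,
        coeff_mul_mono_of_le, Nat.sub_self, zero_add, zero_sub, neg_eq_zero] using this
  · rcases htype with hs | ht
    · have := coeff_eq_zero_of_mem hP' (hyz' hs) (i := e + t) (j := 0) (l := 0) (by omega)
        (by omega) (by omega) (by omega) (by omega) (by omega)
      simpa (disch := omega) only [coeff_add, coeff_sub, coeff_mul_mono_of_lt,
        coeff_mul_mono_of_le, Nat.sub_self, zero_add, zero_sub, neg_eq_zero] using this
    · have := coeff_eq_zero_of_mem hP' hyz (i := e + t) (j := b) (l := 0) (by omega)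
        (by omega) (by omega) (by omega) (by omega) (by omega)
      simpa (disch := omega) only [coeff_add, coeff_sub, coeff_mul_mono_of_lt,
        coeff_mul_mono_of_le, Nat.sub_self, zero_add, zero_sub, neg_eq_zero] using this

lemma symbolicPower_three_le_irrelevantIdeal_mul_sq [P.IsPrime]
    (htype : s = 0 ∨ (t = 0 ∧ 0 < s ∧ 0 < β ∧ 0 < γ)) (hex : ¬(β = 0 ∧ e ≤ t ∧ c ≤ γ)) :
    symbolicPower P 3 ≤ irrelevantIdeal k * P ^ 2 := by
  intro f hf
  obtain ⟨hFP, hGP, hHP⟩ := minors_mem hP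
  have hf2 := symbolicPower_three_le_sq hF hG hH he hb hc hP (by omega) hf
  obtain ⟨q₁₁, q₂₂, q₃₃, q₁₂, q₁₃, q₂₃, rfl⟩ := mem_span_triple_sq (hP ▸ hf2)
  obtain ⟨⟨h1, h2, h3⟩, h4, h5, h6⟩ :=
    quadratic_coeffs_mem_irrelevantIdeal hF hG hH he hb hc hP htype hex hf
  simp only [pow_two]
  repeat' apply add_mem
  all_goals
    refine Ideal.mul_mem_mul (by assumption) (Ideal.mul_mem_mul ?_ ?_) <;> assumption

/-- In the exceptional case `P ^ (3)` contains an element that is congruent to `F ^ 2`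
modulo `𝔪 * P ^ 2`. It restricts to `y ^ (4 * b)` on the `y`-axis, whereas `𝔪 * P ^ 2` restricts
to the ideal of `y ^ (4 * b + 1)`. -/
lemma not_symbolicPower_three_le [P.IsPrime] (hs : s = 0) (hβ : β = 0) (het : e ≤ t)
    (hcγ : c ≤ γ) : ¬ symbolicPower P 3 ≤ irrelevantIdeal k * P ^ 2 := by
  subst hs hβ
  obtain ⟨τ, rfl⟩ := Nat.exists_eq_add_of_le het
  obtain ⟨δ, rfl⟩ := Nat.exists_eq_add_of_le hcγ
  have hP' := hP
  rw [hF, hG, hH] at hP'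
  have hX := X_pow_notMem (by omega) (by omega) (by omega) hb (by omega) hc hP'
  obtain ⟨hFP, hGP, hHP⟩ := minors_mem hP
  intro hle
  set D := F ^ 2 - X 0 ^ τ * X 2 ^ (c + (c + δ)) * G ^ 2 -
    2 * X 0 ^ (e + τ) * X 2 ^ (c + δ) * (G * H) - X 0 ^ (e + (e + τ)) * X 2 ^ δ * H ^ 2 with hD
  have hDmem : D ∈ symbolicPower P 3 := by
    apply mem_symbolicPower_of_mul_mem (hX 0 e)
    have h1 := mul_mem_symbolicPower_succ
      (secondGen_mem_symbolicPower hF hG hH he hb hc hP) hGP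
    have h2 := pow_le_symbolicPower 3
      (Ideal.mul_mem_left _ (X 2 ^ δ) (Ideal.pow_mem_pow hHP 3))
    convert sub_mem h1 h2 using 1
    simp only [hD, secondGen, hF, hG, hH, minorF, minorG, minorH]; ring
  let φ : MvPolynomial (Fin 3) k →ₐ[k] Polynomial k := aeval ![0, Polynomial.X, 0]
  have hφm : (irrelevantIdeal k).map φ ≤ Ideal.span {Polynomial.X} := by
    rw [irrelevantIdeal, Ideal.map_span, Ideal.span_le]
    rintro _ ⟨_, rfl | rfl | rfl, rfl⟩ <;> simp [φ]
  have hφP : P.map φ ≤ Ideal.span {Polynomial.X ^ (2 * b)} := by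
    rw [hP', Ideal.map_span, Ideal.span_le]
    rintro _ ⟨_, rfl | rfl | rfl, rfl⟩ <;>
      simp [φ, minorF, minorG, minorH, he.ne', hc.ne', two_mul]
  have hφ := Ideal.mem_map_of_mem φ (hle hDmem)
  rw [Ideal.map_mul, Ideal.map_pow] at hφ
  have hφ' := Ideal.mul_mono hφm (Ideal.pow_right_mono hφP 2) hφ
  rw [Ideal.span_singleton_pow, Ideal.span_singleton_mul_span_singleton,
    Ideal.mem_span_singleton] at hφ'
  have hφD : φ D = Polynomial.X ^ (4 * b) := by
    simp [φ, hD, hF, hG, hH, minorF, minorG, minorH, he.ne', hc.ne']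
    ring
  rw [hφD, ← pow_mul, ← pow_succ', pow_dvd_pow_iff Polynomial.X_ne_zero Polynomial.not_isUnit_X]
    at hφ'
  omega

end SymbolicPowers

end SpaceMonomialCurve

open SpaceMonomialCurve in
theorem theorem1p3 (k : Type*) [Field k] (a₁ a₂ b₁ b₂ c₁ c₂ : ℕ)
    (ha₁ : 0 < a₁) (ha₂ : 0 < a₂) (hb₁ : 0 < b₁) (hb₂ : 0 < b₂) (hc₁ : 0 < c₁) (hc₂ : 0 < c₂)
    (P : Ideal (MvPolynomial (Fin 3) k))
    (hP : P = minorsIdeal 2 (herzogMatrix k a₁ a₂ b₁ b₂ c₁ c₂)) [P.IsPrime]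
    (hM : IsTypeOne a₁ a₂ b₁ b₂ c₁ c₂ ∨ IsTypeTwo a₁ a₂ b₁ b₂ c₁ c₂) :
    (¬ symbolicPower P 3 ≤ irrelevantIdeal k * P ^ 2 ↔
      max 0 (2 * (a₁ : ℤ) - a₂) = 0 ∧ max 0 (2 * (c₂ : ℤ) - c₁) = 0 ∧ (b₂ : ℤ) - b₁ = 0) ∧
    (IsTypeTwo a₁ a₂ b₁ b₂ c₁ c₂ →
      symbolicPower P 3 ≤ irrelevantIdeal k * P ^ 2) := by
  simp only [IsTypeOne, IsTypeTwo] at hM ⊢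
  obtain ⟨e, s, t, rfl, rfl, he, hst⟩ :
      ∃ e s t, a₁ = e + s ∧ a₂ = e + t ∧ 0 < e ∧ (s = 0 ∨ t = 0) :=
    ⟨min a₁ a₂, a₁ - min a₁ a₂, a₂ - min a₁ a₂, by omega, by omega, by omega, by omega⟩
  obtain ⟨β, rfl⟩ : ∃ β, b₁ = b₂ + β := Nat.exists_eq_add_of_le (by omega)
  obtain ⟨γ, rfl⟩ : ∃ γ, c₁ = c₂ + γ := Nat.exists_eq_add_of_le (by omega)
  rw [minorsIdeal_herzogMatrix] at hP
  have hle := symbolicPower_three_le_irrelevantIdeal_mul_sq rfl rfl rfl he hb₂ hc₂ hP (by omega)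
  refine ⟨⟨fun h => ?_, fun h => ?_⟩, fun h => hle (by omega)⟩
  · have := not_not.1 (mt hle h)
    omega
  · exact not_symbolicPower_three_le rfl rfl rfl he hb₂ hc₂ hP (by omega) (by omega) (by omega)
      (by omega)
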